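/- Let $\alpha>-1$ and $\nu\ge 0$. Put $\rho_\nu(x)=2x^{\nu/2}K_\nu(2\sqrt x)$ for $x>0$, where $K_\nu$ is the modified Bessel function of the second kind, and $\rho_\nu(0)=\Gamma(\nu)$ if $\nu>0$. Let $T=[0,1]$ if $\nu>0$ and $T=(0,1]$ if $\nu=0$. For $t\in T$ let $$w_t(x)=x^{\alpha}e^{-(1-t)x}\rho_\nu(xt),\qquad x>0,$$ and let $P_n(x)=P_n(x;1-t,t)=a_nx^n+b_nx^{n-1}+\cdots$, $n=0,1,2,\dots$, be the orthonormal polynomials for this weight: $P_n$ has exact degree $n$ and $\int_0^\infty P_mP_n\,w_t\,dx=\delta_{m,n}$. The coefficients depend on $t$; the signs of the $P_n$ are chosen so that, for each $n$, the sign of $a_n=a_n(t)$ does not depend on $t\in T$ (for instance $a_n>0$). Put $P_{-1}=0$, $b_0=0$, $A_0=0$, $A_n=a_{n-1}/a_n$ for $n\ge1$, and $B_n=b_n/a_n-b_{n+1}/a_{n+1}$ for $n\ge 0$. Derivatives in $t$ are taken relative to $T$, hence are one-sided at the end points. Then: 1. All coefficients of all $P_n$ are differentiable functions of $t$ on $(0,1]$.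 2. For all $t\in T$, $n\ge0$ and $x\in\mathbb R$, $$\Big(t\frac{\partial}{\partial t}-x\frac{\partial}{\partial x}\Big)P_n(x;1-t,t)-\Big[\frac{t}{a_n}\frac{\partial a_n}{\partial t}-n\Big]P_n(x;1-t,t)+A_nP_{n-1}(x;1-t,t)=0,$$ where at $t=0$ the terms with the factor $t$ are read as $0$. 3. For all $t\in T$ and $n\ge 0$ the following derivatives exist and $$\frac{\partial}{\partial t}\Big(\frac{t\,b_n}{a_n}\Big)=-A_n^2,\qquad \frac{\partial}{\partial t}\big(tB_n\big)=A_{n+1}^2-A_n^2 .$$ 4. For all $t\in T$ the sequence $Q_n=\big(t\frac{\partial}{\partial t}-x\frac{\partial}{\partial x}\big)P_n(x;1-t,t)$, $n\ge0$ (again with $t\frac{\partial}{\partial t}$ read as $0$ at $t=0$), is quasi-orthogonal with respect to $w_t$: $Q_n$ is a polynomial in $x$ of degree at most $n$, $\int_0^\infty Q_n(x)x^m w_t(x)\,dx=0$ for $0\le m\le n-2$, and $\int_0^\infty Q_n(x)x^{n-1}w_t(x)\,dx\ne0$ for $n\ge1$. -/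

import Mathlib

open MeasureTheory Set Polynomial

noncomputable section

namespace PrudnikovLaguerre

/-- The modified Bessel function of the second kind (Macdonald function) `K_ν(z)` for real order
`ν` and real argument `z > 0`, by its standard integral
`K_ν(z) = ∫_0^∞ e^{-z cosh u} cosh (ν u) du`. -/
def besselK (ν z : ℝ) : ℝ :=
  ∫ u in Ioi (0 : ℝ), Real.exp (-(z * Real.cosh u)) * Real.cosh (ν * u)

/-- The scaled Macdonald function `ρ_ν(x) = 2 x^{ν/2} K_ν(2 √x)` for `x > 0`, with its value
`ρ_ν(0) = Γ(ν)` at the origin (the limit at `0` when `ν > 0`; not used when `ν = 0`). -/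
def rho (ν x : ℝ) : ℝ :=
  if x = 0 then Real.Gamma ν else 2 * x ^ (ν / 2) * besselK ν (2 * √x)

/-- The two-parameter weight `x^α e^{-l x} ρ_ν(x t)` on `(0, ∞)`. -/
def weight (α ν l t x : ℝ) : ℝ :=
  x ^ α * Real.exp (-(l * x)) * rho ν (x * t)

/-- `p 0, p 1, …` are orthonormal polynomials on `(0, ∞)` for the weight `w`: `p n` has exact
degree `n` and `∫ p_m p_n w = δ_{m,n}`. -/
def IsOrthonormalSeq (w : ℝ → ℝ) (p : ℕ → ℝ[X]) : Prop :=
  (∀ n, (p n).degree = n) ∧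
    ∀ m n, ∫ x in Ioi (0 : ℝ), (p m).eval x * (p n).eval x * w x = if m = n then 1 else 0

/-- The admissible parameters: `0 ≤ t ≤ 1`, where `t = 0` is allowed only if `ν > 0`
(for `ν = 0` the weight is infinite at `t = 0`). -/
def params (ν : ℝ) : Set ℝ := {t | 0 ≤ t ∧ t ≤ 1 ∧ (0 < t ∨ 0 < ν)}

/-- The leading coefficient `a_n` in `p_n = a_n x^n + b_n x^{n-1} + …`. -/
def aCoeff (p : ℕ → ℝ[X]) (n : ℕ) : ℝ := (p n).coeff n

/-- The subleading coefficient `b_n` in `p_n = a_n x^n + b_n x^{n-1} + …`, with `b_0 = 0`. -/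
def bCoeff (p : ℕ → ℝ[X]) : ℕ → ℝ
  | 0 => 0
  | n + 1 => (p (n + 1)).coeff n

/-- `A_n = a_{n-1} / a_n`, with `A_0 = 0` (from `p_{-1} = 0`). -/
def recA (p : ℕ → ℝ[X]) : ℕ → ℝ
  | 0 => 0
  | n + 1 => aCoeff p n / aCoeff p (n + 1)

/-- `B_n = b_n / a_n - b_{n+1} / a_{n+1}`. -/
def recB (p : ℕ → ℝ[X]) (n : ℕ) : ℝ :=
  bCoeff p n / aCoeff p n - bCoeff p (n + 1) / aCoeff p (n + 1)

/-- `(t ∂_t - x ∂_x) P_n` at `(x, t)`. The family is `P t n`, the parameter runs through `T`, and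
the derivative in `t` is one-sided at the end points of `T`. -/
def eulerOp (T : Set ℝ) (P : ℝ → ℕ → ℝ[X]) (n : ℕ) (t x : ℝ) : ℝ :=
  t * derivWithin (fun s => (P s n).eval x) T t - x * (derivative (P t n)).eval x

/-- The sequence `q 0, q 1, …` is quasi-orthogonal (of order one) on `(0, ∞)` for the weight `w`:
`q n` is a polynomial of degree at most `n` with `∫ q_n x^m w = 0` for `0 ≤ m ≤ n - 2` and,
if `n ≥ 1`, `∫ q_n x^{n-1} w ≠ 0`. -/
def IsQuasiOrthogonalSeq (w : ℝ → ℝ) (q : ℕ → ℝ → ℝ) : Prop :=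
  ∀ n, (∃ r : ℝ[X], r.natDegree ≤ n ∧ ∀ x, q n x = r.eval x) ∧
    (∀ m, m + 2 ≤ n → ∫ x in Ioi (0 : ℝ), q n x * x ^ m * w x = 0) ∧
    (1 ≤ n → ∫ x in Ioi (0 : ℝ), q n x * x ^ (n - 1) * w x ≠ 0)

end PrudnikovLaguerre

end

namespace PrudnikovLaguerre

/-! ### The Macdonald function -/

/-! Write `μ_k(t)` for the moments of the weight and `L` for the functional they define. For `t > 0`
the substitution `u = tx` gives `μ_k(t) = t^{-(α+k+1)} ∫ e^{-(1/t-1)u} u^{α+k} ρ_ν(u) du`, so that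
all dependence on `t` sits in a power and a Laplace transform. Hence `t μ_k' = μ_{k+1} - (α+k+1)
μ_k` (`hasDerivWithinAt_moment`). At `t = 0` the weight is `Γ(ν) x^α e^{-x}` and the right side
vanishes (`moment_zero_succ`), so the same relation holds there with left side `0`.

Applying `t d/dt` to `L(P_n x^m) = 0`, `m < n`, yields `L(Q_n x^m) = -L(P_n x^{m+1})` for `Q_n =
(t∂_t - x∂_x)P_n` (`momentFunctional_eulerPoly_mul_X_pow`). The right side is `0` for `m ≤ n-2` and
`-1/a_n` for `m = n-1`: this is quasi-orthogonality. Since `deg Q_n ≤ n`, it also forces `Q_n = c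
P_n - A_n P_{n-1}` (`eq_of_shifted_moments`). The leading coefficient gives `c`, and the coefficient
of `x^{n-1}` gives the derivative of `t b_n/a_n`.

The coefficients inherit regularity from the moments through Gram–Schmidt
(`coeff_mem_of_moments_mem`): differentiability for `t > 0`, continuity at `t = 0`. Continuity
suffices there, because `t g(t)` has derivative `g(0)` at `0`. -/

lemma rpow_mul_exp_neg_le {p z : ℝ} (hp : 0 < p) (hz : 0 ≤ z) :
    z ^ p * Real.exp (-z) ≤ p ^ p := by
  have h1 : z / p ≤ Real.exp (z / p) := by linarith [Real.add_one_le_exp (z / p)]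
  have h2 : (z / p) ^ p ≤ Real.exp z := by
    calc (z / p) ^ p ≤ (Real.exp (z / p)) ^ p :=
          Real.rpow_le_rpow (by positivity) h1 hp.le
      _ = Real.exp z := by rw [← Real.exp_mul, div_mul_cancel₀ _ hp.ne']
  rw [Real.div_rpow hz hp.le, div_le_iff₀ (by positivity)] at h2
  rw [Real.exp_neg, ← div_eq_mul_inv, div_le_iff₀ (Real.exp_pos _)]
  linarith

/-- The integrand in `ρ_ν(x) = ∫_0^∞ y^{ν-1} e^{-y-x/y} dy`. -/
noncomputable def rhoKernel (ν x y : ℝ) : ℝ := y ^ (ν - 1) * Real.exp (-(y + x / y))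

lemma rhoKernel_nonneg (ν x : ℝ) {y : ℝ} (hy : 0 < y) : 0 ≤ rhoKernel ν x y := by
  unfold rhoKernel; positivity

lemma measurable_rhoKernel (ν x : ℝ) : Measurable (rhoKernel ν x) := by
  unfold rhoKernel; fun_prop

/-- The factor `e^{-x/y}` is traded for a multiple of `(x/y)^{-p}`. The free exponent `p` serves
both ends: small `p` near `x = 0`, large `p` at infinity. -/
lemma rhoKernel_le_rpow {ν p x y : ℝ} (hp : 0 < p) (hx : 0 < x) (hy : 0 < y) :
    rhoKernel ν x y ≤ p ^ p * x ^ (-p) * (Real.exp (-y) * y ^ (ν + p - 1)) := by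
  have h := rpow_mul_exp_neg_le hp (div_pos hx hy).le
  have h3 : Real.exp (-(x / y)) ≤ p ^ p * (x ^ (-p) * y ^ p) := by
    rw [Real.div_rpow hx.le hy.le] at h
    have : x ^ p / y ^ p * Real.exp (-(x / y)) * (x ^ (-p) * y ^ p) = Real.exp (-(x / y)) := by
      rw [Real.rpow_neg hx.le]
      have h1 : x ^ p ≠ 0 := (Real.rpow_pos_of_pos hx p).ne'
      have h2 : y ^ p ≠ 0 := (Real.rpow_pos_of_pos hy p).ne'
      field_simp
    rw [← this]
    gcongr
  calc rhoKernel ν x y = y ^ (ν - 1) * Real.exp (-y) * Real.exp (-(x / y)) := by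
        rw [rhoKernel, neg_add, Real.exp_add, mul_assoc]
    _ ≤ y ^ (ν - 1) * Real.exp (-y) * (p ^ p * (x ^ (-p) * y ^ p)) := by gcongr
    _ = _ := by
        rw [show ν + p - 1 = (ν - 1) + p by ring, Real.rpow_add hy]; ring

lemma rhoKernel_le_gamma (ν : ℝ) {x y : ℝ} (hx : 0 ≤ x) (hy : 0 < y) :
    rhoKernel ν x y ≤ Real.exp (-y) * y ^ (ν - 1) := by
  rw [rhoKernel, mul_comm]
  gcongr
  have := div_nonneg hx hy.le
  linarith

lemma integrableOn_rhoKernel {ν x : ℝ} (hν : 0 ≤ ν) (hx : 0 < x) :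
    IntegrableOn (rhoKernel ν x) (Ioi 0) := by
  refine Integrable.mono' ((Real.GammaIntegral_convergent
    (show 0 < ν + 1 by linarith)).const_mul ((1 : ℝ) ^ (1 : ℝ) * x ^ (-(1 : ℝ))))
    (measurable_rhoKernel ν x).aestronglyMeasurable ?_
  filter_upwards [ae_restrict_mem measurableSet_Ioi] with y hy
  rw [Real.norm_of_nonneg (rhoKernel_nonneg ν x hy)]
  exact rhoKernel_le_rpow one_pos hx hy

lemma image_mul_exp_univ {c : ℝ} (hc : 0 < c) :
    (fun u : ℝ => c * Real.exp u) '' univ = Ioi 0 := by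
  ext y
  simp only [image_univ, mem_range, mem_Ioi]
  constructor
  · rintro ⟨u, rfl⟩; positivity
  · intro hy
    refine ⟨Real.log (y / c), ?_⟩
    rw [Real.exp_log (by positivity)]; field_simp

/-- The substitution `y = √x e^u` turns `y + x/y` into `2√x cosh u`. Symmetrizing in `u` then
replaces `e^{νu}` by `cosh (νu)`, and evenness folds the line onto the half-line. -/
lemma rho_eq_integral {ν x : ℝ} (hν : 0 ≤ ν) (hx : 0 < x) :
    rho ν x = ∫ y in Ioi (0 : ℝ), rhoKernel ν x y := by
  have hs : 0 < √x := Real.sqrt_pos.2 hx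
  set f : ℝ → ℝ := fun u => Real.exp (-(2 * √x * Real.cosh u)) * Real.exp (ν * u) with hf
  have hpt : ∀ u, |√x * Real.exp u| • rhoKernel ν x (√x * Real.exp u) = x ^ (ν / 2) * f u := by
    intro u
    have he := Real.exp_pos u
    have hc : 0 < √x * Real.exp u := by positivity
    rw [abs_of_pos hc, smul_eq_mul, rhoKernel, ← mul_assoc]
    have h1 : √x * Real.exp u * (√x * Real.exp u) ^ (ν - 1) = x ^ (ν / 2) * Real.exp (ν * u) := by
      rw [Real.rpow_sub_one hc.ne', mul_div_cancel₀ _ hc.ne', Real.mul_rpow hs.le he.le,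
        ← Real.exp_mul, Real.sqrt_eq_rpow, ← Real.rpow_mul hx.le]
      ring_nf
    have h2 : √x * Real.exp u + x / (√x * Real.exp u) = 2 * √x * Real.cosh u := by
      rw [Real.cosh_eq, Real.exp_neg]
      field_simp
      rw [Real.sq_sqrt hx.le]
      ring
    rw [h1, h2, hf]
    ring
  have hd : ∀ u ∈ (univ : Set ℝ), HasDerivWithinAt (fun u : ℝ => √x * Real.exp u)
      (√x * Real.exp u) univ u := fun u _ =>
    ((Real.hasDerivAt_exp u).const_mul _).hasDerivWithinAt
  have hinj : InjOn (fun u : ℝ => √x * Real.exp u) univ := fun u _ v _ h =>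
    Real.exp_injective (mul_left_cancel₀ hs.ne' h)
  have hint := integral_image_eq_integral_abs_deriv_smul MeasurableSet.univ hd hinj (rhoKernel ν x)
  have hion := integrableOn_image_iff_integrableOn_abs_deriv_smul MeasurableSet.univ hd hinj
    (rhoKernel ν x)
  rw [image_mul_exp_univ hs] at hint hion
  simp only [hpt] at hint hion
  have hxp : x ^ (ν / 2) ≠ 0 := (Real.rpow_pos_of_pos hx _).ne'
  have hfi : Integrable f := by
    have h := hion.1 (integrableOn_rhoKernel hν hx)
    rw [integrableOn_univ] at h
    exact (integrable_const_mul_iff (IsUnit.mk0 _ hxp) f).1 h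
  rw [setIntegral_univ, integral_const_mul] at hint
  rw [hint, rho, if_neg hx.ne', besselK]
  have habs : ∫ u, Real.exp (-(2 * √x * Real.cosh u)) * Real.cosh (ν * u)
      = 2 * ∫ u in Ioi (0 : ℝ), Real.exp (-(2 * √x * Real.cosh u)) * Real.cosh (ν * u) := by
    rw [← integral_comp_abs]
    refine integral_congr_ae (Filter.Eventually.of_forall fun u => ?_)
    simp only [Real.cosh_abs]
    rw [← Real.cosh_abs (ν * u), ← Real.cosh_abs (ν * |u|), abs_mul, abs_mul, abs_abs]
  have hsym : ∫ u, Real.exp (-(2 * √x * Real.cosh u)) * Real.cosh (ν * u) = ∫ u, f u := by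
    have h1 : ∀ u, Real.exp (-(2 * √x * Real.cosh u)) * Real.cosh (ν * u)
        = (f u + f (-u)) / 2 := by
      intro u
      simp only [hf, Real.cosh_neg]
      rw [Real.cosh_eq (ν * u)]
      ring_nf
    simp only [h1]
    rw [integral_div, integral_add hfi hfi.comp_neg, integral_neg_eq_self f volume]
    ring
  rw [← hsym, habs]
  ring

lemma rho_nonneg {ν x : ℝ} (hν : 0 ≤ ν) (hx : 0 < x) : 0 ≤ rho ν x := by
  rw [rho_eq_integral hν hx]
  exact setIntegral_nonneg measurableSet_Ioi fun y hy => rhoKernel_nonneg ν x hy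

lemma rho_le_rpow {ν p x : ℝ} (hν : 0 ≤ ν) (hp : 0 < p) (hx : 0 < x) :
    rho ν x ≤ p ^ p * Real.Gamma (ν + p) * x ^ (-p) := by
  have hνp : 0 < ν + p := by linarith
  rw [rho_eq_integral hν hx, Real.Gamma_eq_integral hνp, mul_right_comm, ← integral_const_mul]
  exact setIntegral_mono_on (integrableOn_rhoKernel hν hx)
    ((Real.GammaIntegral_convergent hνp).const_mul _) measurableSet_Ioi
    fun y hy => rhoKernel_le_rpow hp hx hy

lemma rho_le_gamma {ν x : ℝ} (hν : 0 < ν) (hx : 0 ≤ x) : rho ν x ≤ Real.Gamma ν := by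
  rcases hx.eq_or_lt with rfl | hx
  · simp [rho]
  rw [rho_eq_integral hν.le hx, Real.Gamma_eq_integral hν]
  exact setIntegral_mono_on (integrableOn_rhoKernel hν.le hx)
    (Real.GammaIntegral_convergent hν) measurableSet_Ioi
    fun y hy => rhoKernel_le_gamma ν hx.le hy

lemma continuousWithinAt_rho_zero {ν : ℝ} (hν : 0 < ν) :
    ContinuousWithinAt (rho ν) (Ici 0) 0 := by
  have h0 : ∫ y in Ioi (0 : ℝ), rhoKernel ν 0 y = Real.Gamma ν := by
    rw [Real.Gamma_eq_integral hν]
    refine setIntegral_congr_fun measurableSet_Ioi fun y _ => ?_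
    simp [rhoKernel, mul_comm]
  have hc : ContinuousWithinAt (fun x => ∫ y in Ioi (0 : ℝ), rhoKernel ν x y) (Ici 0) 0 := by
    refine continuousWithinAt_of_dominated (bound := fun y => Real.exp (-y) * y ^ (ν - 1))
      (Filter.Eventually.of_forall fun x => (measurable_rhoKernel ν x).aestronglyMeasurable)
      ?_ (Real.GammaIntegral_convergent hν) ?_
    · filter_upwards [self_mem_nhdsWithin] with x hx
      filter_upwards [ae_restrict_mem measurableSet_Ioi] with y hy
      rw [Real.norm_of_nonneg (rhoKernel_nonneg ν x hy)]
      exact rhoKernel_le_gamma ν hx hy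
    · filter_upwards with y
      unfold rhoKernel
      fun_prop
  refine hc.congr (fun x hx => ?_) (by rw [h0]; simp [rho])
  rcases (show (0 : ℝ) ≤ x from hx).eq_or_lt with rfl | hx
  · rw [h0]; simp [rho]
  · exact rho_eq_integral hν.le hx

lemma measurable_rho (ν : ℝ) : Measurable (rho ν) := by
  have hK : Measurable (besselK ν) := by
    have : Measurable (Function.uncurry fun z u : ℝ =>
        Real.exp (-(z * Real.cosh u)) * Real.cosh (ν * u)) := by
      have h := Real.continuous_cosh
      apply Continuous.measurable
      unfold Function.uncurry
      fun_prop
    exact (this.stronglyMeasurable.integral_prod_right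
      (ν := volume.restrict (Ioi (0 : ℝ)))).measurable
  unfold rho
  refine Measurable.ite (measurableSet_eq) measurable_const ?_
  exact (by fun_prop : Measurable fun x : ℝ => 2 * x ^ (ν / 2)).mul
    (hK.comp (by fun_prop))

lemma integrableOn_rpow_mul_rho {ν s : ℝ} (hν : 0 ≤ ν) (hs : -1 < s) :
    IntegrableOn (fun x => x ^ s * rho ν x) (Ioi 0) := by
  have hm : Measurable fun x : ℝ => x ^ s * rho ν x :=
    (by fun_prop : Measurable fun x : ℝ => x ^ s).mul (measurable_rho ν)
  have hb : ∀ p, 0 < p → ∀ x, 0 < x →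
      ‖x ^ s * rho ν x‖ ≤ p ^ p * Real.Gamma (ν + p) * x ^ (s - p) := by
    intro p hp x hx
    have h := rho_le_rpow hν hp hx
    rw [Real.norm_of_nonneg (mul_nonneg (by positivity) (rho_nonneg hν hx)),
      sub_eq_add_neg, Real.rpow_add hx]
    calc x ^ s * rho ν x ≤ x ^ s * (p ^ p * Real.Gamma (ν + p) * x ^ (-p)) := by gcongr
      _ = _ := by ring
  rw [← Ioc_union_Ioi_eq_Ioi zero_le_one]
  refine IntegrableOn.union ?_ ?_
  -- With `p = (s+1)/2` the remaining exponent `(s-1)/2` is still above `-1`.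
  · have hp : 0 < (s + 1) / 2 := by linarith
    have hi : IntegrableOn (fun x : ℝ => x ^ (s - (s + 1) / 2)) (Ioc 0 1) :=
      (intervalIntegral.intervalIntegrable_rpow' (by linarith)).1
    refine Integrable.mono' (hi.const_mul (((s + 1) / 2) ^ ((s + 1) / 2) *
      Real.Gamma (ν + (s + 1) / 2))) hm.aestronglyMeasurable ?_
    filter_upwards [ae_restrict_mem measurableSet_Ioc] with x hx
    exact hb _ hp x hx.1
  -- With `p = s+2` the bound at infinity is a multiple of `x^{-2}`.
  · have hp : 0 < s + 2 := by linarith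
    have hi : IntegrableOn (fun x : ℝ => x ^ (s - (s + 2))) (Ioi 1) :=
      integrableOn_Ioi_rpow_of_lt (by linarith) one_pos
    refine Integrable.mono' (hi.const_mul ((s + 2) ^ (s + 2) * Real.Gamma (ν + (s + 2))))
      hm.aestronglyMeasurable ?_
    filter_upwards [ae_restrict_mem measurableSet_Ioi] with x hx
    exact hb _ hp x (one_pos.trans hx)

/-! ### Laplace transforms -/

/-- The `C¹` extension of `l ↦ e^{-l x}` from `l ≥ 0` to the real line that is linear in
`l ≤ 0`. -/
noncomputable def expExtend (x l : ℝ) : ℝ := if l ≤ 0 then 1 - l * x else Real.exp (-(l * x))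

lemma hasDerivAt_expExtend (x l : ℝ) :
    HasDerivAt (expExtend x) (-x * Real.exp (-(max l 0 * x))) l := by
  have h1 : ∀ l : ℝ, HasDerivAt (fun l : ℝ => 1 - l * x) (-x) l := fun l => by
    simpa using ((hasDerivAt_id l).mul_const x).const_sub 1
  have h2 : ∀ l : ℝ, HasDerivAt (fun l : ℝ => Real.exp (-(l * x)))
      (-x * Real.exp (-(l * x))) l := fun l => by
    have := ((hasDerivAt_id l).mul_const x).neg.exp
    simpa [mul_comm] using this
  rcases lt_trichotomy l 0 with hl | rfl | hl
  · rw [max_eq_right hl.le]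
    refine HasDerivAt.congr_of_eventuallyEq (by simpa using h1 l) ?_
    filter_upwards [Iio_mem_nhds hl] with y hy
    simp [expExtend, (show y < 0 from hy).le]
  · rw [max_self, ← hasDerivWithinAt_univ, ← Iic_union_Ici (a := (0 : ℝ))]
    refine HasDerivWithinAt.union ?_ ?_
    · refine (HasDerivAt.hasDerivWithinAt (by simpa using h1 0)).congr
        (f := fun l : ℝ => 1 - l * x) (fun y hy => ?_) ?_
      · simp [expExtend, show y ≤ 0 from hy]
      · simp [expExtend]
    · refine (h2 0).hasDerivWithinAt.congr (fun y hy => ?_) ?_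
      · rcases (show (0 : ℝ) ≤ y from hy).eq_or_lt with rfl | hy
        · simp [expExtend]
        · simp [expExtend, not_le.2 hy]
      · simp [expExtend]
  · rw [max_eq_left hl.le]
    refine (h2 l).congr_of_eventuallyEq ?_
    filter_upwards [Ioi_mem_nhds hl] with y hy
    simp [expExtend, not_le.2 (show 0 < y from hy)]

/-- A Laplace transform is differentiable on the closed half-line if the differentiated
integrand is integrable at the end point. -/
lemma hasDerivWithinAt_laplace {g : ℝ → ℝ} (hg : IntegrableOn g (Ioi 0))
    (hg1 : IntegrableOn (fun x => x * g x) (Ioi 0)) {l : ℝ} (hl : 0 ≤ l) :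
    HasDerivWithinAt (fun l => ∫ x in Ioi (0 : ℝ), Real.exp (-(l * x)) * g x)
      (-∫ x in Ioi (0 : ℝ), Real.exp (-(l * x)) * (x * g x)) (Ici 0) l := by
  have hme : ∀ l, Measurable fun x => expExtend x l := fun l => by
    unfold expExtend
    split_ifs <;> fun_prop
  have h1 : ∀ l ∈ Ici (0 : ℝ), ∀ x, expExtend x l = Real.exp (-(l * x)) := by
    intro l hl x
    rcases (show (0 : ℝ) ≤ l from hl).eq_or_lt with rfl | hl
    · simp [expExtend]
    · simp [expExtend, not_le.2 hl]
  have hx0 := ae_restrict_mem (μ := volume) (measurableSet_Ioi (a := (0 : ℝ)))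
  -- Two-sided differentiation at `l = 0` would involve the growing exponentials of `l < 0`. The
  -- linear extension instead has `l`-derivative bounded by `x` for all real `l`.
  have key := (hasDerivAt_integral_of_dominated_loc_of_deriv_le
    (μ := volume.restrict (Ioi (0 : ℝ))) (x₀ := l) (s := univ)
    (F := fun l x => expExtend x l * g x)
    (F' := fun l x => -x * Real.exp (-(max l 0 * x)) * g x)
    (bound := fun x => ‖x * g x‖) Filter.univ_mem
    (Filter.Eventually.of_forall fun l => (hme l).aestronglyMeasurable.mul hg.1) ?_ ?_ ?_ hg1.norm
    ?_).2
  · rw [← integral_neg]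
    refine (HasDerivWithinAt.congr (key.hasDerivWithinAt (s := Ici 0)) (fun y hy => ?_)
      ?_).congr_deriv ?_
    · simp only [h1 y hy]
    · simp only [h1 l hl]
    · simp only [max_eq_left hl]
      congr 1; ext x; ring
  · refine Integrable.mono' hg.norm ((hme l).aestronglyMeasurable.mul hg.1) ?_
    filter_upwards [hx0] with x hx
    simp only [h1 l hl]
    rw [norm_mul, Real.norm_of_nonneg (Real.exp_pos _).le]
    refine mul_le_of_le_one_left (norm_nonneg _) (Real.exp_le_one_iff.2 ?_)
    have := mul_nonneg hl (show (0 : ℝ) < x from hx).le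
    linarith
  · exact AEStronglyMeasurable.mul (by fun_prop) hg.1
  · filter_upwards [hx0] with x hx l _
    rw [mul_right_comm, norm_mul, Real.norm_of_nonneg (Real.exp_pos _).le, neg_mul, norm_neg]
    refine mul_le_of_le_one_right (norm_nonneg _) (Real.exp_le_one_iff.2 ?_)
    have := mul_nonneg (le_max_right l 0) (show (0 : ℝ) < x from hx).le
    linarith
  · filter_upwards with x l _
    exact (hasDerivAt_expExtend x l).mul_const _

/-! ### Moments of the weight -/

/-- The `k`-th moment of the weight `x^α e^{-(1-t)x} ρ_ν(xt)`. -/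
noncomputable def moment (α ν : ℝ) (k : ℕ) (t : ℝ) : ℝ :=
  ∫ x in Ioi (0 : ℝ), x ^ k * weight α ν (1 - t) t x

lemma pow_mul_weight {α ν l t x : ℝ} (k : ℕ) (hx : 0 < x) :
    x ^ k * weight α ν l t x = x ^ (α + k) * Real.exp (-(l * x)) * rho ν (x * t) := by
  rw [weight, Real.rpow_add hx, Real.rpow_natCast]; ring

lemma pow_mul_weight_scaled {α ν t x : ℝ} (k : ℕ) (ht : 0 < t) (hx : 0 < x) :
    x ^ k * weight α ν (1 - t) t x = t ^ (-(α + k)) *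
      (Real.exp (-((t⁻¹ - 1) * (t * x))) * ((t * x) ^ (α + k) * rho ν (t * x))) := by
  rw [pow_mul_weight k hx, Real.mul_rpow ht.le hx.le, Real.rpow_neg ht.le, mul_comm x t]
  have h : t ^ (α + k) ≠ 0 := (Real.rpow_pos_of_pos ht _).ne'
  have h2 : (t⁻¹ - 1) * (t * x) = (1 - t) * x := by field_simp
  rw [h2]
  field_simp

lemma add_natCast_gt {α : ℝ} (hα : -1 < α) (k : ℕ) : -1 < α + k := by
  have : (0 : ℝ) ≤ k := k.cast_nonneg
  linarith

lemma weight_zero (α ν x : ℝ) :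
    weight α ν (1 - 0) 0 x = Real.Gamma ν * (Real.exp (-x) * x ^ α) := by
  simp only [weight, rho, sub_zero, one_mul, mul_zero, if_true]; ring

lemma pow_mul_weight_zero {α ν x : ℝ} (k : ℕ) (hx : 0 < x) :
    x ^ k * weight α ν (1 - 0) 0 x =
      Real.Gamma ν * (Real.exp (-x) * x ^ (α + k + 1 - 1)) := by
  rw [weight_zero, add_sub_cancel_right, Real.rpow_add hx, Real.rpow_natCast]; ring

lemma integrableOn_pow_mul_weight {α ν t : ℝ} (hα : -1 < α) (hν : 0 ≤ ν) (ht : t ∈ params ν)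
    (k : ℕ) : IntegrableOn (fun x => x ^ k * weight α ν (1 - t) t x) (Ioi 0) := by
  have hk := add_natCast_gt hα k
  rcases ht.1.eq_or_lt with rfl | h0
  · refine IntegrableOn.congr_fun ((Real.GammaIntegral_convergent
      (show 0 < α + k + 1 by linarith)).const_mul (Real.Gamma ν))
      (fun x hx => (pow_mul_weight_zero k hx).symm) measurableSet_Ioi
  · have hl : 0 ≤ t⁻¹ - 1 := sub_nonneg.2 ((one_le_inv₀ h0).2 ht.2.1)
    have hi : IntegrableOn (fun u => Real.exp (-((t⁻¹ - 1) * u)) * (u ^ (α + k) * rho ν u))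
        (Ioi 0) := by
      have h := integrableOn_rpow_mul_rho hν hk
      refine Integrable.mono' h.norm (AEStronglyMeasurable.mul (by fun_prop) h.1) ?_
      filter_upwards [ae_restrict_mem measurableSet_Ioi] with x hx
      rw [norm_mul, Real.norm_of_nonneg (Real.exp_pos _).le]
      refine mul_le_of_le_one_left (norm_nonneg _) (Real.exp_le_one_iff.2 ?_)
      have := mul_nonneg hl (show (0 : ℝ) < x from hx).le
      linarith
    have h := (integrableOn_Ioi_comp_mul_left_iff
      (fun u => Real.exp (-((t⁻¹ - 1) * u)) * (u ^ (α + k) * rho ν u)) 0 h0).2 (by simpa using hi)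
    exact IntegrableOn.congr_fun (h.const_mul (t ^ (-(α + k))))
      (fun x hx => (pow_mul_weight_scaled k h0 hx).symm) measurableSet_Ioi

/-- The functional equation of `Γ`; it plays the part of the moment derivative formula at `t = 0`.
-/
lemma moment_zero_succ {α ν : ℝ} (hα : -1 < α) (k : ℕ) :
    moment α ν (k + 1) 0 = (α + k + 1) * moment α ν k 0 := by
  have h : ∀ k : ℕ, moment α ν k 0 = Real.Gamma ν * Real.Gamma (α + k + 1) := by
    intro k
    have hk := add_natCast_gt hα k
    rw [moment, Real.Gamma_eq_integral (show 0 < α + k + 1 by linarith), ← integral_const_mul]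
    exact setIntegral_congr_fun measurableSet_Ioi fun x hx => pow_mul_weight_zero k hx
  have hk := add_natCast_gt hα k
  rw [h, h, Nat.cast_succ, ← add_assoc, Real.Gamma_add_one (by linarith)]
  ring

lemma moment_eq_laplace {α ν t : ℝ} (ht : 0 < t) (k : ℕ) :
    moment α ν k t = t ^ (-(α + k + 1)) *
      ∫ u in Ioi (0 : ℝ), Real.exp (-((t⁻¹ - 1) * u)) * (u ^ (α + k) * rho ν u) := by
  rw [moment, setIntegral_congr_fun measurableSet_Ioi fun x hx => pow_mul_weight_scaled k ht hx,
    integral_const_mul, integral_comp_mul_left_Ioi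
      (fun u => Real.exp (-((t⁻¹ - 1) * u)) * (u ^ (α + k) * rho ν u)) 0 ht,
    mul_zero, smul_eq_mul, ← mul_assoc, neg_add _ (1 : ℝ), Real.rpow_add ht,
    Real.rpow_neg_one]

lemma params_pos_mem_nhdsWithin {ν t : ℝ} (ht : 0 < t) : Ioc 0 1 ∈ nhdsWithin t (params ν) := by
  filter_upwards [self_mem_nhdsWithin, mem_nhdsWithin_of_mem_nhds (Ioi_mem_nhds ht)] with s hs h
  exact ⟨h, hs.2.1⟩

/-- Product and chain rule for the Laplace representation in `l = 1/t - 1`. The end point `t = 1`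
corresponds to `l = 0`, which is why the transform is needed on the closed half-line. -/
lemma hasDerivWithinAt_moment {α ν t : ℝ} (hα : -1 < α) (hν : 0 ≤ ν) (ht : t ∈ params ν)
    (h0 : 0 < t) (k : ℕ) :
    HasDerivWithinAt (moment α ν k)
      (t⁻¹ * (moment α ν (k + 1) t - (α + k + 1) * moment α ν k t)) (params ν) t := by
  refine HasDerivWithinAt.mono_of_mem_nhdsWithin (t := Ioc 0 1) ?_ (params_pos_mem_nhdsWithin h0)
  have hk := add_natCast_gt hα k
  have hsplit : ∀ u ∈ Ioi (0 : ℝ),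
      u ^ (α + (k + 1 : ℕ)) * rho ν u = u * (u ^ (α + k) * rho ν u) := by
    intro u hu
    rw [Nat.cast_succ, ← add_assoc, Real.rpow_add_one (ne_of_gt hu)]; ring
  have hl : 0 ≤ t⁻¹ - 1 := sub_nonneg.2 ((one_le_inv₀ h0).2 ht.2.1)
  have hM := hasDerivWithinAt_laplace (integrableOn_rpow_mul_rho hν hk)
    ((integrableOn_rpow_mul_rho hν (add_natCast_gt hα (k + 1))).congr_fun hsplit
      measurableSet_Ioi) hl
  have hinv : HasDerivWithinAt (fun s : ℝ => s⁻¹ - 1) (-(t ^ 2)⁻¹) (Ioc 0 1) t :=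
    ((hasDerivAt_inv h0.ne').sub_const 1).hasDerivWithinAt
  have hcomp := hM.comp t hinv fun s hs => sub_nonneg.2 ((one_le_inv₀ hs.1).2 hs.2)
  have hpow : HasDerivWithinAt (fun s : ℝ => s ^ (-(α + k + 1)))
      (-(α + k + 1) * t ^ (-(α + k + 1) - 1)) (Ioc 0 1) t :=
    (Real.hasDerivAt_rpow_const (Or.inl h0.ne')).hasDerivWithinAt
  refine ((hpow.mul hcomp).congr (fun s hs => moment_eq_laplace hs.1 k)
    (moment_eq_laplace h0 k)).congr_deriv ?_
  have hnext : moment α ν (k + 1) t = t ^ (-(α + k + 1)) * t⁻¹ *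
      ∫ u in Ioi (0 : ℝ), Real.exp (-((t⁻¹ - 1) * u)) * (u * (u ^ (α + k) * rho ν u)) := by
    rw [moment_eq_laplace h0, setIntegral_congr_fun (g := fun u =>
      Real.exp (-((t⁻¹ - 1) * u)) * (u * (u ^ (α + k) * rho ν u))) measurableSet_Ioi
      fun u hu => by simp only [hsplit u hu]]
    rw [← Real.rpow_neg_one t, ← Real.rpow_add h0]
    congr 2
    push_cast; ring
  rw [hnext, moment_eq_laplace h0 k, Real.rpow_sub_one h0.ne']
  simp only [Function.comp]
  field_simp
  ring

lemma continuousWithinAt_moment_zero {α ν : ℝ} (hα : -1 < α) (hν : 0 < ν) (k : ℕ) :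
    ContinuousWithinAt (moment α ν k) (params ν) 0 := by
  have hk := add_natCast_gt hα k
  have hmeas : ∀ t, Measurable fun x => x ^ k * weight α ν (1 - t) t x := fun t => by
    have := (measurable_rho ν).comp (measurable_id.mul_const t)
    unfold weight
    exact (measurable_id.pow_const k).mul (Measurable.mul (by fun_prop) this)
  have hI : IntegrableOn (fun x : ℝ => x ^ (α + k) * Real.exp (-(1 / 2) * x)) (Ioi 0) := by
    simpa using integrableOn_rpow_mul_exp_neg_mul_rpow (p := 1) hk one_pos (b := 1 / 2) (by norm_num)
  unfold moment
  refine continuousWithinAt_of_dominated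
    (bound := fun x => x ^ (α + k) * Real.exp (-(1 / 2) * x) * Real.Gamma ν)
    (Filter.Eventually.of_forall fun t => (hmeas t).aestronglyMeasurable)
    ?_ (hI.mul_const _) ?_
  -- For `t < 1/2` the exponential is at most `e^{-x/2}`, a bound uniform in `t`.
  · filter_upwards [self_mem_nhdsWithin,
      mem_nhdsWithin_of_mem_nhds (Iio_mem_nhds (show (0 : ℝ) < 1 / 2 by norm_num))] with t ht ht2
    filter_upwards [ae_restrict_mem measurableSet_Ioi] with x hx
    have hx : 0 < x := hx
    have ht2 : t < 1 / 2 := ht2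
    have hxt : 0 ≤ x * t := mul_nonneg hx.le ht.1
    have hr : 0 ≤ rho ν (x * t) := by
      rcases hxt.eq_or_lt with h | h
      · rw [← h, rho, if_pos rfl]; exact (Real.Gamma_pos_of_pos hν).le
      · exact rho_nonneg hν.le h
    rw [pow_mul_weight k hx, Real.norm_of_nonneg (by positivity)]
    gcongr
    · nlinarith
    · exact rho_le_gamma hν hxt
  · filter_upwards [ae_restrict_mem measurableSet_Ioi] with x hx
    have hx : 0 < x := hx
    have hr : ContinuousWithinAt (fun t => rho ν (x * t)) (params ν) 0 := by
      refine ContinuousWithinAt.comp (t := Ici 0) (g := rho ν) ?_ (by fun_prop)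
        fun t ht => mul_nonneg hx.le ht.1
      simpa using continuousWithinAt_rho_zero hν
    unfold weight
    exact continuousWithinAt_const.mul (ContinuousWithinAt.mul (by fun_prop) hr)

/-! ### Moment functionals and orthonormal polynomials -/

/-- The linear functional on polynomials with moments `μ 0, μ 1, …`. -/
noncomputable def momentFunctional (μ : ℕ → ℝ) : ℝ[X] →ₗ[ℝ] ℝ :=
  Polynomial.lsum fun k => μ k • LinearMap.id

lemma momentFunctional_C_mul_X_pow (μ : ℕ → ℝ) (c : ℝ) (k : ℕ) :
    momentFunctional μ (C c * X ^ k) = c * μ k := by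
  rw [momentFunctional, Polynomial.lsum_apply, C_mul_X_pow_eq_monomial,
    sum_monomial_index _ _ (by simp)]
  simp [mul_comm]

lemma momentFunctional_mul_X_pow (μ : ℕ → ℝ) {q : ℝ[X]} {N : ℕ} (hq : q.natDegree < N) (m : ℕ) :
    momentFunctional μ (q * X ^ m) = ∑ k ∈ Finset.range N, q.coeff k * μ (k + m) := by
  conv_lhs => rw [q.as_sum_range_C_mul_X_pow' hq]
  rw [Finset.sum_mul, map_sum]
  refine Finset.sum_congr rfl fun k _ => ?_
  rw [mul_assoc, ← pow_add, momentFunctional_C_mul_X_pow]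

lemma integral_eval_mul_eq_momentFunctional {w : ℝ → ℝ}
    (hw : ∀ k : ℕ, IntegrableOn (fun x => x ^ k * w x) (Ioi 0)) (q : ℝ[X]) :
    ∫ x in Ioi (0 : ℝ), q.eval x * w x =
      momentFunctional (fun k => ∫ x in Ioi (0 : ℝ), x ^ k * w x) q := by
  have h := momentFunctional_mul_X_pow (fun k => ∫ x in Ioi (0 : ℝ), x ^ k * w x)
    (Nat.lt_succ_self q.natDegree) 0
  rw [pow_zero, mul_one] at h
  rw [h]
  simp only [add_zero, ← integral_const_mul]
  rw [← integral_finsetSum _ fun k _ => (hw k).const_mul (q.coeff k)]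
  congr 1
  ext x
  rw [eval_eq_sum_range, Finset.sum_mul]
  exact Finset.sum_congr rfl fun k _ => by ring

/-- `p 0, p 1, …` are orthonormal polynomials for the functional `L`. -/
def IsOrthonormalFor (L : ℝ[X] →ₗ[ℝ] ℝ) (p : ℕ → ℝ[X]) : Prop :=
  (∀ n, (p n).degree = n) ∧ ∀ m n, L (p m * p n) = if m = n then 1 else 0

lemma map_C_mul (L : ℝ[X] →ₗ[ℝ] ℝ) (c : ℝ) (q : ℝ[X]) : L (C c * q) = c * L q := by
  rw [← smul_eq_C_mul, map_smul, smul_eq_mul]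

lemma degree_C_mul_le (c : ℝ) (q : ℝ[X]) : (C c * q).degree ≤ q.degree := by
  rw [← smul_eq_C_mul]
  exact degree_smul_le c q

lemma degree_lt_of_degree_lt_succ {q : ℝ[X]} {n : ℕ} (hq : q.degree < (n + 1 : ℕ))
    (h0 : q.coeff n = 0) : q.degree < n := by
  rw [degree_lt_iff_coeff_zero] at hq ⊢
  intro m hm
  rcases hm.eq_or_lt with rfl | hm
  · exact h0
  · exact hq m hm

namespace IsOrthonormalFor

variable {L : ℝ[X] →ₗ[ℝ] ℝ} {p : ℕ → ℝ[X]}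

lemma natDegree_eq (h : IsOrthonormalFor L p) (n : ℕ) : (p n).natDegree = n :=
  natDegree_eq_of_degree_eq_some (h.1 n)

lemma degree_lt_succ (h : IsOrthonormalFor L p) (n : ℕ) : (p n).degree < (n + 1 : ℕ) := by
  rw [h.1 n]; exact_mod_cast n.lt_succ_self

lemma aCoeff_ne_zero (h : IsOrthonormalFor L p) (n : ℕ) : aCoeff p n ≠ 0 := by
  have h0 : p n ≠ 0 := fun h0 => by simpa [h0] using h.1 n
  have := leadingCoeff_ne_zero.2 h0
  rwa [leadingCoeff, h.natDegree_eq] at this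

/-- Removing the top coefficient with a multiple of `p n` leaves the induction hypothesis
applicable; then `q` is that multiple, and pairing with `p n` kills it. Positivity of `L` plays no
role. -/
lemma eq_zero_of_forall (h : IsOrthonormalFor L p) (n : ℕ) {q : ℝ[X]} (hq : q.degree < n)
    (hL : ∀ j < n, L (q * p j) = 0) : q = 0 := by
  induction n generalizing q with
  | zero => exact degree_eq_bot.1 (by simpa using hq)
  | succ n ih =>
    have ha := h.aCoeff_ne_zero n
    have hq' : q - C (q.coeff n / aCoeff p n) * p n = 0 := by
      refine ih (degree_lt_of_degree_lt_succ ?_ ?_) fun j hj => ?_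
      · refine (degree_sub_le _ _).trans_lt (max_lt hq ?_)
        refine (degree_C_mul_le _ _).trans_lt (h.degree_lt_succ n)
      · rw [coeff_sub, coeff_C_mul]
        change _ - _ * aCoeff p n = 0
        field_simp
        ring
      · rw [sub_mul, map_sub, mul_assoc, map_C_mul, h.2, if_neg hj.ne', hL j (by omega)]
        simp
    have hqe := sub_eq_zero.1 hq'
    have hn := hL n n.lt_succ_self
    rw [hqe, mul_assoc, map_C_mul, h.2, if_pos rfl, mul_one] at hn
    rw [hqe, hn]
    simp

lemma eq_sum (h : IsOrthonormalFor L p) (n : ℕ) {q : ℝ[X]} (hq : q.degree < n) :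
    q = ∑ j ∈ Finset.range n, C (L (q * p j)) * p j := by
  refine sub_eq_zero.1 (h.eq_zero_of_forall n ?_ fun i hi => ?_)
  · refine (degree_sub_le _ _).trans_lt (max_lt hq ?_)
    refine (degree_sum_le _ _).trans_lt ((Finset.sup_lt_iff (WithBot.bot_lt_coe n)).2 fun j hj => ?_)
    refine (degree_C_mul_le _ _).trans_lt ?_
    rw [h.1 j]
    exact WithBot.coe_lt_coe.2 (Finset.mem_range.1 hj)
  · rw [sub_mul, map_sub, Finset.sum_mul, map_sum]
    simp only [mul_assoc, map_C_mul, h.2]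
    simp [hi]

lemma map_mul_eq_zero (h : IsOrthonormalFor L p) (n : ℕ) {q : ℝ[X]} (hq : q.degree < n) :
    L (p n * q) = 0 := by
  rw [h.eq_sum n hq, Finset.mul_sum, map_sum]
  refine Finset.sum_eq_zero fun j hj => ?_
  rw [mul_left_comm, map_C_mul, h.2, if_neg (Finset.mem_range.1 hj).ne', mul_zero]

lemma map_mul_X_pow_of_lt (h : IsOrthonormalFor L p) {m n : ℕ} (hm : m < n) :
    L (p n * X ^ m) = 0 :=
  h.map_mul_eq_zero n ((degree_X_pow_le m).trans_lt (by exact_mod_cast hm))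

lemma degree_X_pow_sub_lt (h : IsOrthonormalFor L p) (n : ℕ) :
    (X ^ n - C (1 / aCoeff p n) * p n : ℝ[X]).degree < n := by
  refine degree_lt_of_degree_lt_succ ((degree_sub_le _ _).trans_lt (max_lt ?_ ?_)) ?_
  · exact (degree_X_pow_le n).trans_lt (by exact_mod_cast n.lt_succ_self)
  · exact (degree_C_mul_le _ _).trans_lt (h.degree_lt_succ n)
  · rw [coeff_sub, coeff_C_mul, coeff_X_pow_self]
    change 1 - 1 / aCoeff p n * aCoeff p n = 0
    rw [one_div_mul_cancel (h.aCoeff_ne_zero n), sub_self]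

lemma map_mul_X_pow_self (h : IsOrthonormalFor L p) (n : ℕ) :
    L (p n * X ^ n) = 1 / aCoeff p n := by
  have h0 := h.map_mul_eq_zero n (h.degree_X_pow_sub_lt n)
  rw [mul_sub, map_sub, mul_left_comm, map_C_mul, h.2, if_pos rfl, mul_one] at h0
  linarith

lemma eq_zero_of_forall_X_pow (h : IsOrthonormalFor L p) (n : ℕ) {q : ℝ[X]} (hq : q.degree < n)
    (hL : ∀ m < n, L (q * X ^ m) = 0) : q = 0 := by
  refine h.eq_zero_of_forall n hq fun j hj => ?_
  rw [(p j).as_sum_range_C_mul_X_pow, Finset.mul_sum, map_sum]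
  refine Finset.sum_eq_zero fun k hk => ?_
  rw [h.natDegree_eq, Finset.mem_range] at hk
  rw [mul_left_comm, map_C_mul, hL k (by omega), mul_zero]

/-- The Gram–Schmidt recursion. -/
lemma eq_gramSchmidt (h : IsOrthonormalFor L p) (n : ℕ) :
    p n = C (aCoeff p n) *
      (X ^ n - ∑ j ∈ Finset.range n, C (L (X ^ n * p j)) * p j) := by
  have ha := h.aCoeff_ne_zero n
  have h1 := h.eq_sum n (h.degree_X_pow_sub_lt n)
  have h2 : ∑ j ∈ Finset.range n, C (L ((X ^ n - C (1 / aCoeff p n) * p n) * p j)) * p j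
      = ∑ j ∈ Finset.range n, C (L (X ^ n * p j)) * p j := by
    refine Finset.sum_congr rfl fun j hj => ?_
    rw [sub_mul, map_sub, mul_assoc, map_C_mul, h.2, if_neg (Finset.mem_range.1 hj).ne', mul_zero,
      sub_zero]
  rw [h2] at h1
  rw [← h1, sub_sub_cancel, ← mul_assoc, ← C_mul, mul_one_div_cancel ha, C_1, one_mul]

/-- A polynomial of degree at most `n` whose moments up to order `n - 1` are the shifted moments
of `-p_n` is a combination of `p_n` and `p_{n-1}`. -/
lemma eq_of_shifted_moments (h : IsOrthonormalFor L p) (n : ℕ) {q : ℝ[X]} (hq : q.natDegree ≤ n)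
    (hL : ∀ m < n, L (q * X ^ m) = -L (p n * X ^ (m + 1))) :
    q = C (q.coeff n / aCoeff p n) * p n - C (recA p n) * p (n - 1) := by
  have ha := h.aCoeff_ne_zero n
  have hqd : q.degree < (n + 1 : ℕ) :=
    (natDegree_le_iff_degree_le.1 hq).trans_lt (by exact_mod_cast n.lt_succ_self)
  refine sub_eq_zero.1 (h.eq_zero_of_forall_X_pow n (degree_lt_of_degree_lt_succ ?_ ?_)
    fun m hm => ?_)
  · refine (degree_sub_le _ _).trans_lt (max_lt hqd ((degree_sub_le _ _).trans_lt (max_lt ?_ ?_)))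
    · exact (degree_C_mul_le _ _).trans_lt (h.degree_lt_succ n)
    · refine (degree_C_mul_le _ _).trans_lt ?_
      rw [h.1]
      exact_mod_cast (by omega : n - 1 < n + 1)
  · simp only [coeff_sub, coeff_C_mul]
    -- For `n = 0` truncated subtraction makes `p (n - 1)` equal to `p 0`, so the vanishing comes
    -- from `recA p 0 = 0`.
    have h1 : recA p n * (p (n - 1)).coeff n = 0 := by
      rcases n with _ | n
      · simp [recA]
      · rw [coeff_eq_zero_of_natDegree_lt, mul_zero]
        rw [h.natDegree_eq]; omega
    rw [h1]
    change _ - (_ / aCoeff p n * aCoeff p n - 0) = 0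
    rw [div_mul_cancel₀ _ ha]; ring
  · rw [sub_mul, sub_mul, map_sub, map_sub, mul_assoc, mul_assoc, map_C_mul, map_C_mul, hL m hm,
      h.map_mul_X_pow_of_lt hm]
    obtain ⟨n, rfl⟩ : ∃ k, n = k + 1 := ⟨n - 1, by omega⟩
    -- Only the top order gives nonzero terms; they cancel because `A_n / a_{n-1} = 1 / a_n`.
    rcases (Nat.lt_succ_iff.1 hm).eq_or_lt with rfl | hm'
    · have hb := h.aCoeff_ne_zero m
      rw [Nat.add_sub_cancel, h.map_mul_X_pow_self, h.map_mul_X_pow_self, recA]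
      field_simp
      ring
    · rw [Nat.add_sub_cancel, h.map_mul_X_pow_of_lt (by omega), h.map_mul_X_pow_of_lt hm']
      ring

end IsOrthonormalFor

/-! ### Regularity of the coefficients -/

/-- If the moments belong to a class of functions on `T` that is closed under the operations of
the Gram–Schmidt process, then so do the coefficients of the orthonormal polynomials. -/
lemma coeff_mem_of_moments_mem {T : Set ℝ} {t₀ : ℝ} (ht₀ : t₀ ∈ T) {S : (ℝ → ℝ) → Prop}
    (hconst : ∀ c, S fun _ => c) (hadd : ∀ f g, S f → S g → S fun t => f t + g t)
    (hmul : ∀ f g, S f → S g → S fun t => f t * g t)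
    (hsqrt : ∀ f, S f → 0 < f t₀ → S fun t => √(f t)⁻¹)
    (hcongr : ∀ f g, S f → EqOn g f T → S g) {μ : ℕ → ℝ → ℝ} (hμ : ∀ k, S (μ k))
    {P : ℝ → ℕ → ℝ[X]}
    (hP : ∀ t ∈ T, IsOrthonormalFor (momentFunctional fun k => μ k t) (P t))
    (hsign : ∀ n, ∀ s ∈ T, ∀ t ∈ T, 0 < aCoeff (P s) n * aCoeff (P t) n) (n k : ℕ) :
    S fun t => (P t n).coeff k := by
  have hsum : ∀ (N : ℕ) (f : ℕ → ℝ → ℝ), (∀ j < N, S (f j)) →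
      S fun t => ∑ j ∈ Finset.range N, f j t := by
    intro N f hf
    induction N with
    | zero => simpa using hconst 0
    | succ N ih =>
      simp only [Finset.sum_range_succ]
      exact hadd _ _ (ih fun j hj => hf j (by omega)) (hf N N.lt_succ_self)
  induction n using Nat.strong_induction_on generalizing k with
  | _ n ih =>
  set G : ℝ → ℝ[X] := fun t => X ^ n - ∑ j ∈ Finset.range n,
    C (momentFunctional (fun k => μ k t) (X ^ n * P t j)) * P t j with hG
  have hPG : ∀ t ∈ T, P t n = C (aCoeff (P t) n) * G t := fun t ht => (hP t ht).eq_gramSchmidt n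
  have hGS : ∀ k, S fun t => (G t).coeff k := by
    intro k
    have h1 : S fun t => ∑ j ∈ Finset.range n,
        (-1) * ((∑ i ∈ Finset.range (j + 1), (P t j).coeff i * μ (i + n) t) * (P t j).coeff k) :=
      hsum n _ fun j hj => hmul _ _ (hconst _) (hmul _ _ (hsum _ _ fun i _ =>
        hmul _ _ (ih j hj i) (hμ _)) (ih j hj k))
    refine hcongr _ _ (hadd _ _ (hconst ((X ^ n : ℝ[X]).coeff k)) h1) fun t ht => ?_
    simp only [hG, coeff_sub, finsetSum_coeff, coeff_C_mul, neg_one_mul, Finset.sum_neg_distrib]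
    rw [← sub_eq_add_neg]
    congr 1
    refine Finset.sum_congr rfl fun j _ => ?_
    rw [mul_comm (X ^ n), momentFunctional_mul_X_pow (N := j + 1)]
    rw [(hP t ht).natDegree_eq]; omega
  have hGd : ∀ t ∈ T, (G t).natDegree < n + 1 := by
    intro t ht
    rw [← natDegree_C_mul ((hP t ht).aCoeff_ne_zero n), ← hPG t ht, (hP t ht).natDegree_eq]
    omega
  -- `H t = L(G x^n)` for the monic polynomial `G = P_n / a_n`, so `H = 1 / a_n²`.
  set H : ℝ → ℝ := fun t => ∑ i ∈ Finset.range (n + 1), (G t).coeff i * μ (i + n) t with hH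
  have hHS : S H := hsum _ _ fun i _ => hmul _ _ (hGS i) (hμ _)
  have hHa : ∀ t ∈ T, (H t)⁻¹ = aCoeff (P t) n ^ 2 := by
    intro t ht
    have ha := (hP t ht).aCoeff_ne_zero n
    have h1 := (hP t ht).map_mul_X_pow_self n
    rw [hPG t ht, mul_assoc, map_C_mul, momentFunctional_mul_X_pow _ (hGd t ht)] at h1
    change _ * H t = _ at h1
    have h2 : H t = (aCoeff (P t) n ^ 2)⁻¹ := by
      field_simp at h1 ⊢
      linarith
    rw [h2, inv_inv]
  have hHpos : 0 < H t₀ := by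
    have := (hP t₀ ht₀).aCoeff_ne_zero n
    rw [← inv_pos, hHa t₀ ht₀]; positivity
  have haS : S fun t => aCoeff (P t) n := by
    -- The square root recovers only `|a_n|`; the fixed sign of `a_n` over `T` supplies the rest as
    -- a constant factor.
    refine hcongr _ _ (hmul _ _ (hconst (SignType.sign (aCoeff (P t₀) n) : ℝ))
      (hsqrt H hHS hHpos)) fun t ht => ?_
    have hs := hsign n t₀ ht₀ t ht
    simp only [hHa t ht, Real.sqrt_sq_eq_abs]
    rcases pos_and_pos_or_neg_and_neg_of_mul_pos hs with ⟨h1, h2⟩ | ⟨h1, h2⟩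
    · simp [sign_pos h1, abs_of_pos h2]
    · simp [sign_neg h1, abs_of_neg h2]
  refine hcongr _ _ (hmul _ _ haS (hGS k)) fun t ht => ?_
  conv_lhs => rw [hPG t ht, coeff_C_mul]

/-! ### The Euler operator on the orthonormal polynomials -/

lemma isOrthonormalFor_moment {α ν t : ℝ} (hα : -1 < α) (hν : 0 ≤ ν) (ht : t ∈ params ν)
    {p : ℕ → ℝ[X]} (hp : IsOrthonormalSeq (weight α ν (1 - t) t) p) :
    IsOrthonormalFor (momentFunctional fun k => moment α ν k t) p := by
  refine ⟨hp.1, fun m n => ?_⟩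
  have h := integral_eval_mul_eq_momentFunctional (integrableOn_pow_mul_weight hα hν ht) (p m * p n)
  simp only [eval_mul] at h
  rw [hp.2 m n] at h
  exact h.symm

section Coefficients

variable {α ν : ℝ} {P : ℝ → ℕ → ℝ[X]}

lemma differentiableWithinAt_coeff (hα : -1 < α) (hν : 0 ≤ ν)
    (hP : ∀ t ∈ params ν, IsOrthonormalFor (momentFunctional fun k => moment α ν k t) (P t))
    (hsign : ∀ n, ∀ s ∈ params ν, ∀ t ∈ params ν, 0 < aCoeff (P s) n * aCoeff (P t) n)
    {t : ℝ} (ht : t ∈ params ν) (h0 : 0 < t) (n k : ℕ) :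
    DifferentiableWithinAt ℝ (fun s => (P s n).coeff k) (params ν) t :=
  coeff_mem_of_moments_mem (μ := moment α ν) ht
    (S := fun f => DifferentiableWithinAt ℝ f (params ν) t)
    (fun c => differentiableWithinAt_const c) (fun _ _ hf hg => hf.fun_add hg)
    (fun _ _ hf hg => hf.fun_mul hg)
    (fun _ hf hpos => (hf.fun_inv hpos.ne').sqrt (inv_pos.2 hpos).ne')
    (fun _ _ hf h => hf.congr h (h ht))
    (fun k => (hasDerivWithinAt_moment hα hν ht h0 k).differentiableWithinAt) hP hsign n k

lemma continuousWithinAt_coeff_zero (hα : -1 < α) (h0 : 0 ∈ params ν)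
    (hP : ∀ t ∈ params ν, IsOrthonormalFor (momentFunctional fun k => moment α ν k t) (P t))
    (hsign : ∀ n, ∀ s ∈ params ν, ∀ t ∈ params ν, 0 < aCoeff (P s) n * aCoeff (P t) n)
    (n k : ℕ) : ContinuousWithinAt (fun s => (P s n).coeff k) (params ν) 0 :=
  coeff_mem_of_moments_mem (μ := moment α ν) h0
    (S := fun f => ContinuousWithinAt f (params ν) 0)
    (fun _ => continuousWithinAt_const) (fun _ _ hf hg => hf.add hg)
    (fun _ _ hf hg => hf.mul hg) (fun _ hf hpos => (hf.inv₀ hpos.ne').sqrt)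
    (fun _ _ hf h => hf.congr h (h h0))
    (continuousWithinAt_moment_zero hα (h0.2.2.resolve_left (lt_irrefl 0))) hP hsign n k

lemma uniqueDiffWithinAt_params {t : ℝ} (ht : t ∈ params ν) (h0 : 0 < t) :
    UniqueDiffWithinAt ℝ (params ν) t :=
  ((uniqueDiffOn_Ioc 0 1) t ⟨h0, ht.2.1⟩).mono fun _ hs => ⟨hs.1.le, hs.2, Or.inl hs.1⟩

/-- The polynomial `(t ∂_t - x ∂_x) P_n`. -/
noncomputable def eulerPoly (T : Set ℝ) (P : ℝ → ℕ → ℝ[X]) (n : ℕ) (t : ℝ) : ℝ[X] :=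
  ∑ k ∈ Finset.range (n + 1),
    C (t * derivWithin (fun s => (P s n).coeff k) T t - k * (P t n).coeff k) * X ^ k

lemma coeff_eulerPoly (T : Set ℝ) (P : ℝ → ℕ → ℝ[X]) (n : ℕ) (t : ℝ) {k : ℕ} (hk : k ≤ n) :
    (eulerPoly T P n t).coeff k =
      t * derivWithin (fun s => (P s n).coeff k) T t - k * (P t n).coeff k := by
  simp only [eulerPoly, finsetSum_coeff, coeff_C_mul_X_pow]
  rw [Finset.sum_ite_eq, if_pos (Finset.mem_range.2 (by omega))]

lemma natDegree_eulerPoly_le (T : Set ℝ) (P : ℝ → ℕ → ℝ[X]) (n : ℕ) (t : ℝ) :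
    (eulerPoly T P n t).natDegree ≤ n :=
  natDegree_sum_le_of_forall_le _ _ fun k hk =>
    (natDegree_C_mul_X_pow_le _ _).trans (by have := Finset.mem_range.1 hk; omega)

lemma mul_eval_derivative (q : ℝ[X]) {N : ℕ} (hq : q.natDegree < N) (x : ℝ) :
    x * (derivative q).eval x = ∑ k ∈ Finset.range N, k * q.coeff k * x ^ k := by
  conv_lhs => rw [q.as_sum_range_C_mul_X_pow' hq]
  rw [derivative_sum, eval_finsetSum, Finset.mul_sum]
  refine Finset.sum_congr rfl fun k _ => ?_
  rcases k with _ | k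
  · simp
  · simp only [derivative_C_mul_X_pow, eval_mul, eval_C, eval_pow, eval_X]
    rw [Nat.add_sub_cancel]
    push_cast
    ring

lemma eulerOp_eq_eval {n : ℕ} {t : ℝ} (ht : t ∈ params ν)
    (hdeg : ∀ s ∈ params ν, (P s n).natDegree = n)
    (hd : 0 < t → ∀ k, DifferentiableWithinAt ℝ (fun s => (P s n).coeff k) (params ν) t) (x : ℝ) :
    eulerOp (params ν) P n t x = (eulerPoly (params ν) P n t).eval x := by
  have h1 : t * derivWithin (fun s => (P s n).eval x) (params ν) t = ∑ k ∈ Finset.range (n + 1),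
      t * derivWithin (fun s => (P s n).coeff k) (params ν) t * x ^ k := by
    -- At `t = 0` the factor `t` annihilates `derivWithin`, whatever its value.
    rcases ht.1.eq_or_lt with rfl | h0
    · simp
    have heq : ∀ s ∈ params ν, (P s n).eval x =
        ∑ k ∈ Finset.range (n + 1), (P s n).coeff k * x ^ k := fun s hs =>
      eval_eq_sum_range' (by rw [hdeg s hs]; omega) x
    have hD : HasDerivWithinAt (fun s => (P s n).eval x) (∑ k ∈ Finset.range (n + 1),
        derivWithin (fun s => (P s n).coeff k) (params ν) t * x ^ k) (params ν) t :=
      (HasDerivWithinAt.fun_sum fun k _ => (hd h0 k).hasDerivWithinAt.mul_const _).congr heq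
        (heq t ht)
    rw [hD.derivWithin (uniqueDiffWithinAt_params ht h0), Finset.mul_sum]
    exact Finset.sum_congr rfl fun k _ => by ring
  rw [eulerOp, h1, mul_eval_derivative _ (N := n + 1) (by rw [hdeg t ht]; omega),
    ← Finset.sum_sub_distrib, eulerPoly, eval_finsetSum]
  refine Finset.sum_congr rfl fun k _ => ?_
  simp only [eval_mul, eval_C, eval_pow, eval_X]
  ring

/-- Differentiated orthogonality. The moment formula contributes the shift `μ_{k+m+1}` and the
factor `-(α+k+m+1)`; its part `-k` is what `-x∂_x` produces, and the rest is a multiple of `L(P_n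
x^m) = 0`. -/
lemma momentFunctional_eulerPoly_mul_X_pow (hα : -1 < α) (hν : 0 ≤ ν)
    (hP : ∀ t ∈ params ν, IsOrthonormalFor (momentFunctional fun k => moment α ν k t) (P t))
    {n : ℕ} {t : ℝ} (ht : t ∈ params ν)
    (hd : 0 < t → ∀ k, DifferentiableWithinAt ℝ (fun s => (P s n).coeff k) (params ν) t)
    {m : ℕ} (hm : m < n) :
    momentFunctional (fun k => moment α ν k t) (eulerPoly (params ν) P n t * X ^ m) =
      -momentFunctional (fun k => moment α ν k t) (P t n * X ^ (m + 1)) := by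
  have hnd : ∀ s ∈ params ν, (P s n).natDegree < n + 1 := fun s hs => by
    rw [(hP s hs).natDegree_eq]; omega
  have hzero : ∀ s ∈ params ν,
      ∑ k ∈ Finset.range (n + 1), (P s n).coeff k * moment α ν (k + m) s = 0 := fun s hs => by
    rw [← momentFunctional_mul_X_pow (fun k => moment α ν k s) (hnd s hs),
      (hP s hs).map_mul_X_pow_of_lt hm]
  have hderiv : ∑ k ∈ Finset.range (n + 1),
      (t * derivWithin (fun s => (P s n).coeff k) (params ν) t * moment α ν (k + m) t +
        (P t n).coeff k *
          (moment α ν (k + m + 1) t - (α + (k + m : ℕ) + 1) * moment α ν (k + m) t)) = 0 := by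
    rcases ht.1.eq_or_lt with rfl | h0
    · refine Finset.sum_eq_zero fun k _ => ?_
      rw [moment_zero_succ hα]
      ring
    · have hD : HasDerivWithinAt
          (fun s => ∑ k ∈ Finset.range (n + 1), (P s n).coeff k * moment α ν (k + m) s) _
          (params ν) t := HasDerivWithinAt.fun_sum fun k _ =>
        (hd h0 k).hasDerivWithinAt.fun_mul (hasDerivWithinAt_moment hα hν ht h0 (k + m))
      have hD0 := (hasDerivWithinAt_const t (params ν) (0 : ℝ)).congr hzero (hzero t ht)
      have h := (uniqueDiffWithinAt_params ht h0).eq_deriv _ hD hD0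
      rw [← mul_zero t, ← h, Finset.mul_sum]
      refine Finset.sum_congr rfl fun k _ => ?_
      field_simp
  rw [momentFunctional_mul_X_pow _ (Nat.lt_succ_of_le (natDegree_eulerPoly_le _ P n t)),
    momentFunctional_mul_X_pow _ (hnd t ht), ← add_eq_zero_iff_eq_neg, ← Finset.sum_add_distrib]
  -- Adding `(α+m+1) L(P_n x^m) = 0` reduces the factor `-(α+k+m+1)` to `-k`.
  have hcomb := congrArg₂ (· + ·) hderiv (congrArg (fun r => (α + m + 1) * r) (hzero t ht))
  simp only [mul_zero, add_zero] at hcomb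
  rw [Finset.mul_sum, ← Finset.sum_add_distrib] at hcomb
  rw [← hcomb]
  refine Finset.sum_congr rfl fun k hk => ?_
  rw [coeff_eulerPoly _ P n t (Nat.lt_succ_iff.1 (Finset.mem_range.1 hk)), ← add_assoc]
  push_cast
  ring

end Coefficients

lemma hasDerivWithinAt_id_mul_zero {g : ℝ → ℝ} {T : Set ℝ} (hg : ContinuousWithinAt g T 0) :
    HasDerivWithinAt (fun s => s * g s) (g 0) T 0 := by
  rw [hasDerivWithinAt_iff_tendsto_slope]
  refine Filter.Tendsto.congr' ?_ (hg.mono sdiff_subset : ContinuousWithinAt g (T \ {0}) 0)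
  filter_upwards [self_mem_nhdsWithin] with s hs
  have : s ≠ 0 := hs.2
  rw [slope_def_field]
  field_simp
  ring

/-- Coefficients of `x^{n-1}` are compared in `heq`. For `t ≠ 0` the quotient rule turns the result
into the claim; at `t = 0` the derivative is the value `b_n/a_n`, which the comparison shows to be
`-A_n²`. -/
lemma hasDerivWithinAt_mul_bCoeff_div_aCoeff {T : Set ℝ} {P : ℝ → ℕ → ℝ[X]} {t : ℝ} (n : ℕ)
    (ha : aCoeff (P t) n ≠ 0)
    (hd : t ≠ 0 → ∀ k, DifferentiableWithinAt ℝ (fun s => (P s n).coeff k) T t)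
    (hc : t = 0 → ∀ k, ContinuousWithinAt (fun s => (P s n).coeff k) T t)
    (heq : eulerPoly T P n t = C ((eulerPoly T P n t).coeff n / aCoeff (P t) n) * P t n
      - C (recA (P t) n) * P t (n - 1)) :
    HasDerivWithinAt (fun s => s * bCoeff (P s) n / aCoeff (P s) n) (-(recA (P t) n) ^ 2) T t := by
  rcases n with _ | n
  · simpa [bCoeff, recA] using hasDerivWithinAt_const t T (0 : ℝ)
  have hco := congrArg (fun q => coeff q n) heq
  simp only [coeff_sub, coeff_C_mul, coeff_eulerPoly T P (n + 1) t n.le_succ,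
    coeff_eulerPoly T P (n + 1) t le_rfl, Nat.add_sub_cancel] at hco
  simp only [bCoeff, recA, aCoeff] at *
  rcases eq_or_ne t 0 with rfl | h0
  · have hq : ContinuousWithinAt (fun s => (P s (n + 1)).coeff n / (P s (n + 1)).coeff (n + 1)) T 0 :=
      (hc rfl n).div (hc rfl (n + 1)) ha
    simp only [mul_div_assoc]
    refine (hasDerivWithinAt_id_mul_zero hq).congr_deriv ?_
    push_cast at hco
    field_simp at hco ⊢
    linarith
  · refine (((hasDerivWithinAt_id t T).fun_mul (hd h0 n).hasDerivWithinAt).fun_div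
      (hd h0 (n + 1)).hasDerivWithinAt ha).congr_deriv ?_
    push_cast at hco
    simp only [id] at *
    field_simp at hco ⊢
    linarith

end PrudnikovLaguerre

/-- In the equation for `P t n` the last term is `0` for `n = 0`, because `recA _ 0 = 0`. -/
theorem mainTheorem11 (α ν : ℝ) (hα : -1 < α) (hν : 0 ≤ ν) (P : ℝ → ℕ → ℝ[X])
    (hP : ∀ t ∈ PrudnikovLaguerre.params ν,
      PrudnikovLaguerre.IsOrthonormalSeq (PrudnikovLaguerre.weight α ν (1 - t) t) (P t))
    (hsign : ∀ n, ∀ s ∈ PrudnikovLaguerre.params ν, ∀ t ∈ PrudnikovLaguerre.params ν,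
      0 < PrudnikovLaguerre.aCoeff (P s) n * PrudnikovLaguerre.aCoeff (P t) n) :
    (∀ n k, DifferentiableOn ℝ (fun t => (P t n).coeff k) (Set.Ioc 0 1)) ∧
    ∀ t ∈ PrudnikovLaguerre.params ν,
      (∀ n x,
        PrudnikovLaguerre.eulerOp (PrudnikovLaguerre.params ν) P n t x
          - (t / PrudnikovLaguerre.aCoeff (P t) n
              * derivWithin (fun s => PrudnikovLaguerre.aCoeff (P s) n)
                  (PrudnikovLaguerre.params ν) t - n) * (P t n).eval x
          + PrudnikovLaguerre.recA (P t) n * (P t (n - 1)).eval x = 0) ∧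
      (∀ n, HasDerivWithinAt
        (fun s => s * PrudnikovLaguerre.bCoeff (P s) n / PrudnikovLaguerre.aCoeff (P s) n)
        (-(PrudnikovLaguerre.recA (P t) n) ^ 2) (PrudnikovLaguerre.params ν) t) ∧
      (∀ n, HasDerivWithinAt (fun s => s * PrudnikovLaguerre.recB (P s) n)
        ((PrudnikovLaguerre.recA (P t) (n + 1)) ^ 2 - (PrudnikovLaguerre.recA (P t) n) ^ 2)
        (PrudnikovLaguerre.params ν) t) ∧
      PrudnikovLaguerre.IsQuasiOrthogonalSeq (PrudnikovLaguerre.weight α ν (1 - t) t)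
        (fun n x => PrudnikovLaguerre.eulerOp (PrudnikovLaguerre.params ν) P n t x) := by
  have hO : ∀ t ∈ PrudnikovLaguerre.params ν, PrudnikovLaguerre.IsOrthonormalFor
      (PrudnikovLaguerre.momentFunctional fun k => PrudnikovLaguerre.moment α ν k t) (P t) :=
    fun t ht => PrudnikovLaguerre.isOrthonormalFor_moment hα hν ht (hP t ht)
  have hd : ∀ t ∈ PrudnikovLaguerre.params ν, 0 < t → ∀ n k, DifferentiableWithinAt ℝ
      (fun s => (P s n).coeff k) (PrudnikovLaguerre.params ν) t := fun t ht h0 =>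
    PrudnikovLaguerre.differentiableWithinAt_coeff hα hν hO hsign ht h0
  have hsub : Ioc 0 1 ⊆ PrudnikovLaguerre.params ν := fun t ht => ⟨ht.1.le, ht.2, Or.inl ht.1⟩
  refine ⟨fun n k t ht => (hd t (hsub ht) ht.1 n k).mono hsub, fun t ht => ?_⟩
  have hE : ∀ n x, PrudnikovLaguerre.eulerOp (PrudnikovLaguerre.params ν) P n t x =
      (PrudnikovLaguerre.eulerPoly (PrudnikovLaguerre.params ν) P n t).eval x := fun n x =>
    PrudnikovLaguerre.eulerOp_eq_eval ht (fun s hs => (hO s hs).natDegree_eq n)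
      (fun h0 => hd t ht h0 n) x
  have hm : ∀ n m, m < n → _ := fun n m hmn =>
    PrudnikovLaguerre.momentFunctional_eulerPoly_mul_X_pow hα hν hO (n := n) ht
      (fun h0 => hd t ht h0 n) (m := m) hmn
  have heq := fun n => (hO t ht).eq_of_shifted_moments n
    (PrudnikovLaguerre.natDegree_eulerPoly_le _ P n t) (hm n)
  have h3 := fun n => PrudnikovLaguerre.hasDerivWithinAt_mul_bCoeff_div_aCoeff n
    ((hO t ht).aCoeff_ne_zero n) (fun h0 => hd t ht (ht.1.lt_of_ne' h0) n)
    (fun h0 k => by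
      subst h0
      exact PrudnikovLaguerre.continuousWithinAt_coeff_zero hα ht hO hsign n k) (heq n)
  have hint : ∀ n m : ℕ, ∫ x in Ioi (0 : ℝ),
      PrudnikovLaguerre.eulerOp (PrudnikovLaguerre.params ν) P n t x * x ^ m *
        PrudnikovLaguerre.weight α ν (1 - t) t x =
      PrudnikovLaguerre.momentFunctional (fun k => PrudnikovLaguerre.moment α ν k t)
        (PrudnikovLaguerre.eulerPoly (PrudnikovLaguerre.params ν) P n t * X ^ m) := by
    intro n m
    have h := PrudnikovLaguerre.integral_eval_mul_eq_momentFunctional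
      (PrudnikovLaguerre.integrableOn_pow_mul_weight hα hν ht)
      (PrudnikovLaguerre.eulerPoly (PrudnikovLaguerre.params ν) P n t * X ^ m)
    simp only [eval_mul, eval_pow, eval_X] at h
    simp only [hE]
    exact h
  refine ⟨fun n x => ?_, h3, fun n => ?_, fun n => ⟨⟨_,
    PrudnikovLaguerre.natDegree_eulerPoly_le _ P n t, hE n⟩, fun m hmn => ?_, fun hn => ?_⟩⟩
  · have ha := (hO t ht).aCoeff_ne_zero n
    have h := congrArg (eval x) (heq n)
    rw [PrudnikovLaguerre.coeff_eulerPoly _ P n t le_rfl] at h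
    simp only [eval_sub, eval_mul, eval_C] at h
    rw [hE, h]
    simp only [PrudnikovLaguerre.aCoeff] at *
    field_simp
    ring
  -- `t B_n` is the difference of two consecutive terms `t b_n/a_n`.
  · refine (((h3 n).fun_sub (h3 (n + 1))).congr_of_mem (fun s _ => ?_) ht).congr_deriv (by ring)
    rw [PrudnikovLaguerre.recB]
    ring
  · rw [hint, hm n m (by omega), (hO t ht).map_mul_X_pow_of_lt (by omega), neg_zero]
  -- The integral equals `-L(P_n x^n) = -1/a_n`.
  · rw [hint, hm n (n - 1) (by omega), Nat.sub_add_cancel hn, (hO t ht).map_mul_X_pow_self]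
    exact neg_ne_zero.2 (one_div_ne_zero ((hO t ht).aCoeff_ne_zero n))
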